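/- Fix real numbers $a,b$ with $0<a<b<1$ and $\frac{\sqrt2\,\sqrt{3+a^2}}{1-b}<3$. There is a constant $K>0$, depending only on the choice of $a,b$, such that the following holds. Let $F(x,y)\in\mathbb{Z}[x,y]$ be a binary form of degree $n\ge 3$, irreducible over $\mathbb{Q}$, with exactly $s+1$ nonzero coefficients, where $n\ge 3s$. Let $H(F)$ be the largest absolute value of a coefficient of $F$, and assume $H(F)>1$. Let $M$ be the smallest Mahler measure among the forms $\pm F(\alpha x+\beta y,\gamma x+\delta y)$ with $\begin{pmatrix}\alpha&\beta\\ \gamma&\delta\end{pmatrix}\in \mathrm{GL}_2(\mathbb{Z})$, where the Mahler measure of $a_n\prod_{i}(x-\gamma_i y)$ is $|a_n|\prod_i\max(1,|\gamma_i|)$. Let $m$ be a positive integer and put $$R=n^{800\log^2 n},\quad C=Rm\bigl(2H(F)\sqrt{n(n+1)}\bigr)^n,\quad \lambda=\frac{\sqrt{2(n+a^2)}}{1-b},\quad A=\frac1{a^2}\Bigl(\log M+\frac n2\Bigr),$$ $$Y_S=\bigl((e^6s)^nR^{2s}m\bigr)^{\frac1{n-2s}},\qquad Y_L=(2C)^{\frac1{n-\lambda}}(4e^A)^{\frac{\lambda}{n-\lambda}}.$$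 Then the number of pairs $(x,y)\in\mathbb{Z}^2$ with $\gcd(x,y)=1$, $|F(x,y)|\le m$, $\min(|x|,|y|)>Y_S$ and $\max(|x|,|y|)\le Y_L$ (the primitive medium solutions) is finite and at most $$K\,s\Bigl(1+\frac{\log m^{1/n}}{\log H(F)}\Bigr)\quad\text{if } n\ge s^4,$$ $$K\,s\log s\,\Bigl(1+\frac{\log m^{1/n}}{\log H(F)}\Bigr)\quad\text{if } 9s^2\le n<s^4,$$ $$K\,s\log s\,\Bigl(1+\frac{s+\log m^{1/n}}{\log H(F)}\Bigr)\quad\text{if } n<9s^2 \text{ and } s\ge 2.$$ -/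

import Mathlib

noncomputable section

namespace ThueMedium

/-- The substitution `F_A(x, y) = F(a x + b y, c x + d y)` for `A = (a, b; c, d)`. -/
def subst (A : Matrix (Fin 2) (Fin 2) ℤ) (F : MvPolynomial (Fin 2) ℤ) :
    MvPolynomial (Fin 2) ℤ :=
  MvPolynomial.aeval
    (fun i => MvPolynomial.C (A i 0) * MvPolynomial.X 0 + MvPolynomial.C (A i 1) * MvPolynomial.X 1)
    F

/-- `G = ± F_A` for some `A ∈ GL₂(ℤ)`. -/
def Equivalent (F G : MvPolynomial (Fin 2) ℤ) : Prop :=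
  ∃ A : GL (Fin 2) ℤ, G = subst A.val F ∨ G = -subst A.val F

/-- The polynomial `F(z, 1)`. -/
def dehomogenize (F : MvPolynomial (Fin 2) ℤ) : Polynomial ℤ :=
  MvPolynomial.aeval ![Polynomial.X, 1] F

/-- The Mahler measure `|a_n| ∏ max(1, |γ_i|)` of `F(x, y) = a_n ∏ (x - γ_i y)`. -/
def mahler (F : MvPolynomial (Fin 2) ℤ) : ℝ :=
  ((dehomogenize F).map (Int.castRingHom ℂ)).mahlerMeasure

/-- The smallest Mahler measure among the forms equivalent to `F`. -/
def minMahler (F : MvPolynomial (Fin 2) ℤ) : ℝ :=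
  sInf {t : ℝ | ∃ G, Equivalent F G ∧ t = mahler G}

/-- The naive height: the largest absolute value of a coefficient. -/
def height (F : MvPolynomial (Fin 2) ℤ) : ℕ :=
  F.support.sup fun d => (F.coeff d).natAbs

/-- `R = n ^ (800 log² n)`. -/
def bigR (n : ℕ) : ℝ := (n : ℝ) ^ (800 * Real.log n ^ 2)

/-- `C = R m (2 H(F) √(n(n+1))) ^ n`. -/
def bigC (F : MvPolynomial (Fin 2) ℤ) (n m : ℕ) : ℝ :=
  bigR n * m * (2 * height F * Real.sqrt (n * (n + 1))) ^ n

/-- `λ = √(2(n + a²)) / (1 - b)`. -/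
def lam (a b : ℝ) (n : ℕ) : ℝ := Real.sqrt (2 * (n + a ^ 2)) / (1 - b)

/-- `A = (log M + n/2) / a²`, with `M` the smallest Mahler measure in the class of `F`. -/
def bigA (a : ℝ) (F : MvPolynomial (Fin 2) ℤ) (n : ℕ) : ℝ :=
  1 / a ^ 2 * (Real.log (minMahler F) + n / 2)

/-- `Y_S = ((e⁶ s)ⁿ R^{2s} m)^{1/(n-2s)}`. -/
def YS (n s m : ℕ) : ℝ :=
  ((Real.exp 6 * s) ^ n * bigR n ^ (2 * s) * m) ^ (1 / ((n : ℝ) - 2 * s))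

/-- `Y_L = (2C)^{1/(n-λ)} (4 e^A)^{λ/(n-λ)}`. -/
def YL (a b : ℝ) (F : MvPolynomial (Fin 2) ℤ) (n m : ℕ) : ℝ :=
  (2 * bigC F n m) ^ (1 / (n - lam a b n)) *
    (4 * Real.exp (bigA a F n)) ^ (lam a b n / (n - lam a b n))

/-- The primitive medium solutions `(x, y)` of `|F(x, y)| ≤ m`. Both `(x, y)` and `(-x, -y)`
are listed. -/
def mediumSolutions (a b : ℝ) (F : MvPolynomial (Fin 2) ℤ) (n s m : ℕ) : Set (ℤ × ℤ) :=
  {p | Int.gcd p.1 p.2 = 1 ∧ |MvPolynomial.eval ![p.1, p.2] F| ≤ (m : ℤ) ∧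
    YS n s m < ((min |p.1| |p.2| : ℤ) : ℝ) ∧ ((max |p.1| |p.2| : ℤ) : ℝ) ≤ YL a b F n m}

end ThueMedium

end

/-!
By Descartes' rule of signs, a real polynomial `f` with `s + 1` terms takes each value at most
`O(s)` times on `(0, ∞)`, so `{|f| < δ}` consists there of `O(s)` intervals. On a geometric
progression of length `s + 1` inside such an interval, an operator of order `s` annihilates all
terms but a chosen one, so every single term of `f` would be small. For `f(z) = F(z, 1)`, two
coprime solutions in the same interval have quotients `x / y` far enough apart to contain such a
progression, and the term of a large coefficient is not small. Hence there are only `O(s)` solutions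
with `Y < max(|x|, |y|) ≤ Y'` as long as `Y'` is at most about `Y ^ κ`, where `κ = n / 2s`.

The first level is `Y_S H ^ (1 / 2n)`, where the coefficient of size `H` is used; every further
level multiplies the exponent of `H` by `κ`, and there a coefficient of size `1` is enough. Since
`log Y_L ≪ log H + n ^ 2 + log m ^ (1 / n)`, the number of levels is
`≪ log n / log κ * (1 + log m ^ (1 / n) / log H)`, and `log n / log κ` is bounded for `n ≥ s ^ 4`
and `≪ log s` always.
-/

noncomputable section

namespace ThueMedium

open Polynomial Finset

section SparsePolynomials

theorem signVariations_lt_card_support {R : Type*} [Semiring R] [LinearOrder R] {p : R[X]}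
    (hp : p ≠ 0) : p.signVariations < #p.support := by
  induction h : #p.support generalizing p with
  | zero => simp_all
  | succ k ih =>
    have hcard : #p.eraseLead.support = k := card_support_eraseLead' h
    have hsucc : p.signVariations ≤ p.eraseLead.signVariations + 1 :=
      signVariations_le_eraseLead_succ p
    by_cases h0 : p.eraseLead = 0
    · have hmonomial : p = monomial p.natDegree p.leadingCoeff := by
        simpa only [h0, zero_add] using (eraseLead_add_monomial_natDegree_leadingCoeff p).symm
      rw [hmonomial, signVariations_monomial]
      exact k.succ_pos
    · have := ih h0 hcard
      omega

theorem card_pos_roots_lt_card_support {R : Type*} [CommRing R] [LinearOrder R]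
    [IsStrictOrderedRing R] {p : R[X]} (hp : p ≠ 0) :
    #{t ∈ p.roots.toFinset | 0 < t} < #p.support := by
  refine lt_of_le_of_lt ?_ (signVariations_lt_card_support hp)
  refine le_trans ?_ p.roots_countP_pos_le_signVariations
  rw [Multiset.countP_eq_card_filter, ← Multiset.toFinset_filter]
  exact Multiset.toFinset_card_le _

theorem exists_finset_pos_eval_eq {f : ℝ[X]} (hf : f.natDegree ≠ 0) (c : ℝ) :
    ∃ Z : Finset ℝ, #Z ≤ #f.support ∧ ∀ t, 0 < t → f.eval t = c → t ∈ Z := by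
  have hfc : f - C c ≠ 0 := by
    intro h
    exact hf (by rw [sub_eq_zero.mp h, natDegree_C])
  have hsupp : (f - C c).support ⊆ insert 0 f.support := by
    intro j hj
    rcases eq_or_ne j 0 with rfl | h0
    · exact mem_insert_self _ _
    · rw [mem_support_iff, coeff_sub, coeff_C_of_ne_zero h0, sub_zero] at hj
      exact mem_insert_of_mem (mem_support_iff.mpr hj)
  refine ⟨{t ∈ (f - C c).roots.toFinset | 0 < t}, ?_, fun t ht hft => ?_⟩
  · have := card_pos_roots_lt_card_support hfc
    have := (card_le_card hsupp).trans (card_insert_le _ _)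
    omega
  · rw [mem_filter, Multiset.mem_toFinset, mem_roots hfc]
    exact ⟨by simp [hft], ht⟩

theorem exists_finset_pos_abs_eval_eq {f : ℝ[X]} (hf : f.natDegree ≠ 0) (δ : ℝ) :
    ∃ Z : Finset ℝ, #Z ≤ 2 * #f.support ∧ ∀ t, 0 < t → |f.eval t| = δ → t ∈ Z := by
  obtain ⟨Z₁, hcard₁, hZ₁⟩ := exists_finset_pos_eval_eq hf δ
  obtain ⟨Z₂, hcard₂, hZ₂⟩ := exists_finset_pos_eval_eq hf (-δ)
  refine ⟨Z₁ ∪ Z₂, (card_union_le _ _).trans (by omega), fun t ht hft => ?_⟩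
  rcases eq_or_eq_neg_of_abs_eq hft with h | h
  · exact mem_union_left _ (hZ₁ t ht h)
  · exact mem_union_right _ (hZ₂ t ht h)

/- The operator `g ↦ (t ↦ g (q t) - q ^ k g t)` multiplies the term of exponent `j` by
`q ^ j - q ^ k`, so it kills the term of exponent `k`. -/
theorem abs_sum_prod_sub_pow_le (f : ℝ[X]) {q δ : ℝ} (hq : 0 ≤ q) (A : Finset ℕ) {t : ℝ}
    (h : ∀ i ≤ #A, |f.eval (q ^ i * t)| ≤ δ) :
    |∑ j ∈ f.support, f.coeff j * (∏ k ∈ A, (q ^ j - q ^ k)) * t ^ j| ≤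
      δ * ∏ k ∈ A, (1 + q ^ k) := by
  induction A using Finset.induction_on generalizing t with
  | empty => simpa [eval_eq_sum, Polynomial.sum] using h 0 (Nat.zero_le _)
  | insert k A hk ih =>
    rw [card_insert_of_notMem hk] at h
    have hshift := ih (t := q * t) fun i hi => by
      rw [← mul_assoc, ← pow_succ]
      exact h (i + 1) (by omega)
    have hself := ih fun i hi => h i (by omega)
    have hsplit : ∑ j ∈ f.support, f.coeff j * (∏ l ∈ insert k A, (q ^ j - q ^ l)) * t ^ j =
        ∑ j ∈ f.support, f.coeff j * (∏ l ∈ A, (q ^ j - q ^ l)) * (q * t) ^ j -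
          q ^ k * ∑ j ∈ f.support, f.coeff j * (∏ l ∈ A, (q ^ j - q ^ l)) * t ^ j := by
      rw [mul_sum, ← sum_sub_distrib]
      refine sum_congr rfl fun j _ => ?_
      rw [prod_insert hk]
      ring
    rw [hsplit, prod_insert hk]
    refine (abs_sub _ _).trans ?_
    rw [abs_mul, abs_of_nonneg (pow_nonneg hq k)]
    linarith [mul_le_mul_of_nonneg_left hself (pow_nonneg hq k)]

theorem abs_coeff_mul_prod_le {f : ℝ[X]} {q δ t : ℝ} (hq : 0 ≤ q)
    (h : ∀ i < #f.support, |f.eval (q ^ i * t)| ≤ δ) {J : ℕ} (hJ : J ∈ f.support) :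
    |f.coeff J * t ^ J| * ∏ k ∈ f.support.erase J, |q ^ J - q ^ k| ≤
      δ * ∏ k ∈ f.support.erase J, (1 + q ^ k) := by
  have hisolated : ∑ j ∈ f.support, f.coeff j * (∏ k ∈ f.support.erase J, (q ^ j - q ^ k)) * t ^ j =
      f.coeff J * (∏ k ∈ f.support.erase J, (q ^ J - q ^ k)) * t ^ J := by
    refine sum_eq_single_of_mem J hJ fun j hj hjJ => ?_
    rw [prod_eq_zero (mem_erase.mpr ⟨hjJ, hj⟩) (sub_self _), mul_zero, zero_mul]
  have hcard : #(f.support.erase J) < #f.support := card_erase_lt_of_mem hJ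
  have hbound := abs_sum_prod_sub_pow_le f hq (f.support.erase J) (t := t) (δ := δ)
    fun i hi => h i (hi.trans_lt hcard)
  rw [hisolated] at hbound
  rwa [← abs_prod, ← abs_mul, mul_right_comm]

theorem le_abs_one_add_pow_sub_pow {ε : ℝ} (hε : 0 ≤ ε) {i j : ℕ} (hij : i ≠ j) :
    ε ≤ |(1 + ε) ^ i - (1 + ε) ^ j| := by
  wlog hlt : i < j generalizing i j
  · rw [abs_sub_comm]
    exact this hij.symm (by omega)
  have hq : 1 ≤ 1 + ε := by linarith
  have hi : 1 ≤ (1 + ε) ^ i := one_le_pow₀ hq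
  have hj : (1 + ε) ^ i * (1 + ε) ≤ (1 + ε) ^ j := by
    rw [← pow_succ]
    exact pow_le_pow_right₀ hq hlt
  rw [abs_sub_comm]
  exact le_trans (by nlinarith) (le_abs_self _)

theorem abs_coeff_mul_pow_le {f : ℝ[X]} {n s : ℕ} (hs : #f.support = s + 1)
    (hn : f.natDegree ≤ n) {ε δ t : ℝ} (hε : 0 ≤ ε) (hεn : (1 + ε) ^ n ≤ 3) (ht : 0 ≤ t)
    (h : ∀ i ≤ s, |f.eval ((1 + ε) ^ i * t)| ≤ δ) (J : ℕ) :
    |f.coeff J| * t ^ J * ε ^ s ≤ δ * 4 ^ s := by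
  have hδ : 0 ≤ δ := (abs_nonneg _).trans (h 0 (Nat.zero_le _))
  by_cases hJ : J ∈ f.support
  swap
  · rw [notMem_support_iff.mp hJ, abs_zero, zero_mul, zero_mul]
    positivity
  have hcard : #(f.support.erase J) = s := by rw [card_erase_of_mem hJ, hs, Nat.add_sub_cancel]
  have hlower : ε ^ s ≤ ∏ k ∈ f.support.erase J, |(1 + ε) ^ J - (1 + ε) ^ k| := by
    rw [← hcard, ← prod_const]
    exact prod_le_prod (fun _ _ => hε) fun k hk =>
      le_abs_one_add_pow_sub_pow hε (mem_erase.mp hk).1.symm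
  have hupper : ∏ k ∈ f.support.erase J, (1 + (1 + ε) ^ k) ≤ 4 ^ s := by
    rw [← hcard, ← prod_const]
    refine prod_le_prod (fun _ _ => by positivity) fun k hk => ?_
    have hkn : k ≤ n := (le_natDegree_of_mem_supp k (mem_of_mem_erase hk)).trans hn
    linarith [pow_le_pow_right₀ (le_add_of_nonneg_right hε) hkn]
  calc |f.coeff J| * t ^ J * ε ^ s = |f.coeff J * t ^ J| * ε ^ s := by
        rw [abs_mul, abs_of_nonneg (pow_nonneg ht J)]
    _ ≤ |f.coeff J * t ^ J| * ∏ k ∈ f.support.erase J, |(1 + ε) ^ J - (1 + ε) ^ k| := by gcongr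
    _ ≤ δ * ∏ k ∈ f.support.erase J, (1 + (1 + ε) ^ k) :=
        abs_coeff_mul_prod_le (by positivity) (fun i hi => h i (by omega)) hJ
    _ ≤ δ * 4 ^ s := by gcongr

theorem card_le_card_level_add_one {g : ℝ → ℝ} (hg : Continuous g) {δ : ℝ} {T Z : Finset ℝ}
    (hT : ∀ t ∈ T, g t < δ)
    (hpeak : ∀ t ∈ T, ∀ t' ∈ T, t < t' → ∃ u ∈ Set.Icc t t', δ ≤ g u)
    (hZ : ∀ t ∈ T, ∀ r > t, g r = δ → r ∈ Z) : #T ≤ #Z + 1 := by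
  refine card_le_of_interleaved fun t ht t' ht' htt' _ => ?_
  obtain ⟨u, hu, hgu⟩ := hpeak t ht t' ht' htt'
  obtain ⟨r, hr, hgr⟩ := intermediate_value_Icc hu.1 hg.continuousOn ⟨(hT t ht).le, hgu⟩
  have htr : t < r := hr.1.lt_of_ne fun h => (hT t ht).ne (h ▸ hgr)
  have hrt' : r < t' := (hr.2.trans hu.2).lt_of_ne fun h => (hT t' ht').ne (h ▸ hgr)
  exact ⟨r, hZ t ht r htr hgr, htr, hrt'⟩

theorem one_add_inv_pow_le_one_add {n s : ℕ} {D : ℝ} (hD : 0 < D) (hs : s ≤ n) (hn : 0 < n) :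
    (1 + (max (n : ℝ) (2 * s * D))⁻¹) ^ s ≤ 1 + 1 / D := by
  set Q := max (n : ℝ) (2 * s * D)
  have hnQ : (n : ℝ) ≤ Q := le_max_left _ _
  have hQ : 0 < Q := lt_of_lt_of_le (by exact_mod_cast hn) hnQ
  have hsQ : (s : ℝ) / Q ≤ 1 := (div_le_one hQ).mpr (le_trans (by exact_mod_cast hs) hnQ)
  have hsD : 2 * (s / Q) ≤ 1 / D := by
    rw [← mul_div_assoc, div_le_div_iff₀ hQ hD, one_mul]
    exact le_max_right _ _
  have hexp : Real.exp (s / Q) ≤ 1 + 2 * (s / Q) := by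
    have hnonneg : 0 ≤ (s : ℝ) / Q := by positivity
    have habs := Real.abs_exp_sub_one_le (x := s / Q) (by rwa [abs_of_nonneg hnonneg])
    rw [abs_of_nonneg hnonneg] at habs
    linarith [le_abs_self (Real.exp (s / Q) - 1)]
  calc (1 + Q⁻¹) ^ s ≤ Real.exp Q⁻¹ ^ s := by
        gcongr
        linarith [Real.add_one_le_exp Q⁻¹]
    _ = Real.exp (s / Q) := by rw [← Real.exp_nat_mul, div_eq_mul_inv]
    _ ≤ 1 + 1 / D := hexp.trans (by linarith)

theorem one_add_inv_pow_le_three {n : ℕ} {Q : ℝ} (hQ : 0 < Q) (hn : n ≤ Q) : (1 + Q⁻¹) ^ n ≤ 3 := by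
  calc (1 + Q⁻¹) ^ n ≤ Real.exp Q⁻¹ ^ n := by
        gcongr
        linarith [Real.add_one_le_exp Q⁻¹]
    _ = Real.exp (n * Q⁻¹) := by rw [← Real.exp_nat_mul]
    _ ≤ Real.exp 1 := by
        gcongr
        rwa [← div_eq_mul_inv, div_le_one hQ]
    _ ≤ 3 := by linarith [Real.exp_one_lt_d9]

/- If two points of `T` had no value of size at least `δ` between them, then `f` would be small
along a geometric progression joining them, hence so would each of its terms. -/
theorem card_le_of_abs_eval_lt {f : ℝ[X]} {n s : ℕ} (hcard : #f.support = s + 1)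
    (hn : f.natDegree ≤ n) (hf : f.natDegree ≠ 0) {D δ : ℝ} (hD : 0 < D) {T : Finset ℝ}
    (hT : ∀ t ∈ T, 0 < t ∧ |f.eval t| < δ)
    (hgap : ∀ t ∈ T, ∀ t' ∈ T, t < t' → t * (1 + 1 / D) ≤ t')
    (hterm : ∀ t ∈ T, ∃ J, δ * (4 * max (n : ℝ) (2 * s * D)) ^ s < |f.coeff J| * t ^ J) :
    #T ≤ 2 * s + 3 := by
  obtain ⟨Z, hZcard, hZ⟩ := exists_finset_pos_abs_eval_eq hf δ
  have hsn : s ≤ n := by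
    have := card_supp_le_succ_natDegree f
    omega
  have hn0 : 0 < n := by omega
  set Q := max (n : ℝ) (2 * s * D)
  have hnQ : (n : ℝ) ≤ Q := le_max_left _ _
  have hQ : 0 < Q := lt_of_lt_of_le (by exact_mod_cast hn0) hnQ
  have hQε : 1 ≤ 1 + Q⁻¹ := by simpa using hQ.le
  have hpeak : ∀ t ∈ T, ∀ t' ∈ T, t < t' → ∃ u ∈ Set.Icc t t', δ ≤ |f.eval u| := by
    intro t ht t' ht' htt'
    by_contra! hsmall
    have ht0 := (hT t ht).1
    obtain ⟨J, hJ⟩ := hterm t ht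
    have hprogression : ∀ i ≤ s, |f.eval ((1 + Q⁻¹) ^ i * t)| ≤ δ := by
      intro i hi
      refine (hsmall _ ⟨le_mul_of_one_le_left ht0.le (one_le_pow₀ hQε), ?_⟩).le
      refine le_trans ?_ (hgap t ht t' ht' htt')
      rw [mul_comm]
      gcongr
      exact (pow_le_pow_right₀ hQε hi).trans (one_add_inv_pow_le_one_add hD hsn hn0)
    have hbound := abs_coeff_mul_pow_le hcard hn (inv_nonneg.mpr hQ.le)
      (one_add_inv_pow_le_three hQ hnQ) ht0.le hprogression J
    rw [inv_pow, ← div_eq_mul_inv, div_le_iff₀ (pow_pos hQ s), mul_assoc, ← mul_pow] at hbound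
    exact hJ.not_ge hbound
  have := card_le_card_level_add_one (f.continuous.abs) (fun t ht => (hT t ht).2) hpeak
    fun t ht r hr => hZ r ((hT t ht).1.trans hr)
  omega

end SparsePolynomials

section Pairs

/-- The coprime pairs `(x, y)` of natural numbers at which the binary form `y ^ n * f (x / y)` of
degree `n` has absolute value at most `m`. -/
def smallPairs (n : ℕ) (f : ℝ[X]) (m : ℝ) : Set (ℕ × ℕ) :=
  {p | p.1.Coprime p.2 ∧ |(p.2 : ℝ) ^ n * f.eval ((p.1 : ℝ) / p.2)| ≤ m}

theorem pow_mul_eval_div {n : ℕ} {f : ℝ[X]} (hf : f.natDegree ≤ n) {x y : ℝ} (hx : x ≠ 0)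
    (hy : y ≠ 0) : x ^ n * (f.reflect n).eval (y / x) = y ^ n * f.eval (x / y) := by
  have : Invertible (x / y) := invertibleOfNonzero (div_ne_zero hx hy)
  have hreflect := eval₂_reflect_mul_pow (RingHom.id ℝ) (x / y) n f hf
  rw [invOf_eq_inv, inv_div, ← eval, ← eval] at hreflect
  rw [← hreflect, div_pow]
  field_simp

theorem swap_mem_smallPairs {n : ℕ} {f : ℝ[X]} {m : ℝ} (hf : f.natDegree ≤ n) {p : ℕ × ℕ}
    (h₁ : p.1 ≠ 0) (h₂ : p.2 ≠ 0) (hp : p ∈ smallPairs n f m) :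
    p.swap ∈ smallPairs n (f.reflect n) m := by
  refine ⟨hp.1.symm, ?_⟩
  rw [Prod.fst_swap, Prod.snd_swap,
    pow_mul_eval_div hf (Nat.cast_ne_zero.mpr h₁) (Nat.cast_ne_zero.mpr h₂)]
  exact hp.2

theorem eq_of_coprime_of_div_eq_div {p p' : ℕ × ℕ} (h : p.1.Coprime p.2) (h' : p'.1.Coprime p'.2)
    (hp : 0 < p.2) (hp' : 0 < p'.2) (heq : (p.1 : ℝ) / p.2 = p'.1 / p'.2) : p = p' := by
  rw [div_eq_div_iff (by positivity) (by positivity)] at heq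
  have hcross : p.1 * p'.2 = p'.1 * p.2 := by exact_mod_cast heq
  have hdvd : p.2 ∣ p'.2 := h.symm.dvd_of_dvd_mul_left (hcross ▸ Dvd.intro_left _ rfl)
  have hdvd' : p'.2 ∣ p.2 := h'.symm.dvd_of_dvd_mul_left (hcross ▸ Dvd.intro_left _ rfl)
  have hsnd : p.2 = p'.2 := Nat.dvd_antisymm hdvd hdvd'
  exact Prod.ext (Nat.eq_of_mul_eq_mul_right hp (by rw [← hcross, hsnd])) hsnd

theorem div_mul_one_add_le_div {p p' : ℕ × ℕ} {D : ℝ} (hx : 0 < p.1) (hy : 0 < p.2)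
    (hy' : 0 < p'.2) (hlt : (p.1 : ℝ) / p.2 < p'.1 / p'.2) (hD : (p.1 : ℝ) * p'.2 ≤ D) :
    (p.1 : ℝ) / p.2 * (1 + 1 / D) ≤ p'.1 / p'.2 := by
  have hxR : (0 : ℝ) < p.1 := by exact_mod_cast hx
  have hyR : (0 : ℝ) < p.2 := by exact_mod_cast hy
  have hyR' : (0 : ℝ) < p'.2 := by exact_mod_cast hy'
  have hcross : (p.1 : ℝ) * p'.2 + 1 ≤ p'.1 * p.2 := by
    rw [div_lt_div_iff₀ hyR hyR'] at hlt
    exact_mod_cast hlt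
  calc (p.1 : ℝ) / p.2 * (1 + 1 / D) ≤ p.1 / p.2 * (1 + 1 / ((p.1 : ℝ) * p'.2)) := by gcongr
    _ = (p.1 * p'.2 + 1) / (p.2 * p'.2) := by field_simp
    _ ≤ (p'.1 * p.2) / (p.2 * p'.2) := by gcongr
    _ = p'.1 / p'.2 := by field_simp

theorem card_le_of_subset_smallPairs {f : ℝ[X]} {n s : ℕ} (hcard : #f.support = s + 1)
    (hn : f.natDegree ≤ n) (hf : f.natDegree ≠ 0) {m Y Y' : ℝ} (hm : 0 < m) (hY : 0 < Y)
    {S : Finset (ℕ × ℕ)} (hS : ↑S ⊆ smallPairs n f m) (hpos : ∀ p ∈ S, 0 < p.1)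
    (hle : ∀ p ∈ S, p.1 ≤ p.2) (hlow : ∀ p ∈ S, Y < p.2) (hup : ∀ p ∈ S, (p.2 : ℝ) ≤ Y')
    (hterm : ∀ p ∈ S, ∃ J, m / Y ^ n * (4 * max (n : ℝ) (2 * s * Y' ^ 2)) ^ s <
      |f.coeff J| * ((p.1 : ℝ) / p.2) ^ J) : #S ≤ 2 * s + 3 := by
  rcases S.eq_empty_or_nonempty with rfl | ⟨p₀, hp₀⟩
  · simp
  have hY' : 0 < Y' := hY.trans ((hlow p₀ hp₀).trans_le (hup p₀ hp₀))
  have hpos₂ : ∀ p ∈ S, 0 < p.2 := fun p hp => (hpos p hp).trans_le (hle p hp)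
  have hinj : Set.InjOn (fun p : ℕ × ℕ => (p.1 : ℝ) / p.2) S := fun p hp p' hp' heq =>
    eq_of_coprime_of_div_eq_div (hS hp).1 (hS hp').1 (hpos₂ p hp) (hpos₂ p' hp') heq
  rw [← card_image_of_injOn hinj]
  refine card_le_of_abs_eval_lt hcard hn hf (D := Y' ^ 2) (δ := m / Y ^ n) (by positivity)
    ?_ ?_ (forall_mem_image.mpr hterm)
  · refine forall_mem_image.mpr fun p hp => ?_
    have hx : (0 : ℝ) < p.1 := by exact_mod_cast hpos p hp
    have hy : (0 : ℝ) < p.2 := by exact_mod_cast hpos₂ p hp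
    refine ⟨by positivity, ?_⟩
    have hval : (p.2 : ℝ) ^ n * |f.eval ((p.1 : ℝ) / p.2)| ≤ m := by
      simpa only [abs_mul, abs_of_pos (pow_pos hy n)] using (hS hp).2
    have hn0 : n ≠ 0 := by omega
    calc |f.eval ((p.1 : ℝ) / p.2)| ≤ m / (p.2 : ℝ) ^ n := by
          rwa [le_div_iff₀ (pow_pos hy n), mul_comm]
      _ < m / Y ^ n := by
          gcongr
          exact hlow p hp
  · refine forall_mem_image.mpr fun p hp => forall_mem_image.mpr fun p' hp' hlt => ?_
    refine div_mul_one_add_le_div (hpos p hp) (hpos₂ p hp) (hpos₂ p' hp') hlt ?_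
    rw [sq]
    have hx : (p.1 : ℝ) ≤ p.2 := by exact_mod_cast hle p hp
    exact mul_le_mul (hx.trans (hup p hp)) (hup p' hp') (Nat.cast_nonneg _) hY'.le

end Pairs

section Levels

/-- `f` is the dehomogenization of a form of degree `n` with `s + 1` terms and height at least `H`
whose two extreme coefficients are at least `1` in absolute value. -/
structure IsSparse (n s : ℕ) (H : ℝ) (f : ℝ[X]) : Prop where
  natDegree_le : f.natDegree ≤ n
  card_support : #f.support = s + 1
  one_le_abs_coeff_zero : 1 ≤ |f.coeff 0|
  one_le_abs_coeff_top : 1 ≤ |f.coeff n|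
  exists_le_abs_coeff : ∃ J ≤ n, H ≤ |f.coeff J|

/-- `y₀` is large enough for coprime pairs exceeding it, at which a form of degree `n` with `s + 1`
terms is at most `m`, to be governed by the gap principle. -/
structure IsGapThreshold (n s : ℕ) (m y₀ : ℝ) : Prop where
  one_le : 1 ≤ y₀
  mul_degree_pow_lt : m * (4 * n) ^ s < y₀ ^ n
  mul_pow_lt : m * (8 * s) ^ s * y₀ ^ (2 * s) < y₀ ^ n

variable {n s : ℕ} {H m y₀ W W' : ℝ} {f : ℝ[X]} {S : Finset (ℕ × ℕ)}

theorem IsSparse.natDegree_ne_zero (hf : IsSparse n s H f) (hn : 0 < n) : f.natDegree ≠ 0 := by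
  have hcoeff : f.coeff n ≠ 0 := abs_pos.mp (one_pos.trans_le hf.one_le_abs_coeff_top)
  exact (hn.trans_le (le_natDegree_of_ne_zero hcoeff)).ne'

theorem IsSparse.pos (hf : IsSparse n s H f) (hn : 0 < n) : 0 < s := by
  have hzero : 0 ∈ f.support :=
    mem_support_iff.mpr (abs_pos.mp (one_pos.trans_le hf.one_le_abs_coeff_zero))
  have htop : n ∈ f.support :=
    mem_support_iff.mpr (abs_pos.mp (one_pos.trans_le hf.one_le_abs_coeff_top))
  have : 1 < #f.support := one_lt_card.mpr ⟨0, hzero, n, htop, hn.ne⟩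
  have := hf.card_support
  omega

theorem IsSparse.reflect (hf : IsSparse n s H f) : IsSparse n s H (f.reflect n) where
  natDegree_le := natDegree_reflect_le.trans (max_le le_rfl hf.natDegree_le)
  card_support := by rw [reflect_support, card_image_of_injective _ (revAt n).injective,
    hf.card_support]
  one_le_abs_coeff_zero := by simpa [coeff_reflect] using hf.one_le_abs_coeff_top
  one_le_abs_coeff_top := by simpa [coeff_reflect, revAt_le] using hf.one_le_abs_coeff_zero
  exists_le_abs_coeff := by
    obtain ⟨J, hJ, hHJ⟩ := hf.exists_le_abs_coeff
    exact ⟨n - J, n.sub_le J, by rwa [coeff_reflect, revAt_le (n.sub_le J), Nat.sub_sub_self hJ]⟩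

theorem abs_coeff_comp_neg_X (f : ℝ[X]) (j : ℕ) : |(f.comp (-X)).coeff j| = |f.coeff j| := by
  have hneg : (-X : ℝ[X]) = C (-1) * X := by simp
  rw [hneg, comp_C_mul_X_coeff, abs_mul, abs_neg_one_pow, mul_one]

theorem IsSparse.comp_neg_X (hf : IsSparse n s H f) : IsSparse n s H (f.comp (-X)) where
  natDegree_le := by simpa [natDegree_comp] using hf.natDegree_le
  card_support := by
    have hsupport : (f.comp (-X)).support = f.support := by
      ext j
      rw [mem_support_iff, mem_support_iff, ← abs_pos, abs_coeff_comp_neg_X, abs_pos]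
    rw [hsupport, hf.card_support]
  one_le_abs_coeff_zero := (abs_coeff_comp_neg_X f 0).symm ▸ hf.one_le_abs_coeff_zero
  one_le_abs_coeff_top := (abs_coeff_comp_neg_X f n).symm ▸ hf.one_le_abs_coeff_top
  exists_le_abs_coeff := by simpa only [abs_coeff_comp_neg_X] using hf.exists_le_abs_coeff

theorem IsGapThreshold.div_pow_mul_max_pow_lt (hy₀ : IsGapThreshold n s m y₀) (hW : 0 < W)
    (hW' : 1 ≤ W') :
    m / (y₀ * W) ^ n * (4 * max (n : ℝ) (2 * s * (y₀ * W') ^ 2)) ^ s < W' ^ (2 * s) / W ^ n := by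
  have hy₀pos : 0 < y₀ ^ n := pow_pos (one_pos.trans_le hy₀.one_le) n
  have hone : (1 : ℝ) ≤ W' ^ (2 * s) := one_le_pow₀ hW'
  have hmax : m * (4 * max (n : ℝ) (2 * s * (y₀ * W') ^ 2)) ^ s < y₀ ^ n * W' ^ (2 * s) := by
    rcases max_choice (n : ℝ) (2 * s * (y₀ * W') ^ 2) with h | h <;> rw [h]
    · exact hy₀.mul_degree_pow_lt.trans_le (le_mul_of_one_le_right hy₀pos.le hone)
    · calc m * (4 * (2 * s * (y₀ * W') ^ 2)) ^ s
          = m * (8 * s) ^ s * y₀ ^ (2 * s) * W' ^ (2 * s) := by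
            rw [pow_mul y₀, pow_mul W', mul_assoc (m * _), ← mul_pow, mul_assoc m, ← mul_pow]
            ring_nf
        _ < y₀ ^ n * W' ^ (2 * s) := by
            gcongr
            exact hy₀.mul_pow_lt
  rw [mul_pow, div_mul_eq_mul_div, div_lt_div_iff₀ (by positivity) (by positivity)]
  linarith [mul_lt_mul_of_pos_right hmax (pow_pos hW n)]

theorem IsSparse.card_level_le (hf : IsSparse n s H f) (hn : 0 < n) (hm : 0 < m)
    (hy₀ : IsGapThreshold n s m y₀) (hW : 0 < W) (hW' : 1 ≤ W')
    (hS : ↑S ⊆ smallPairs n f m) (hpos : ∀ p ∈ S, 0 < p.1) (hle : ∀ p ∈ S, p.1 ≤ p.2)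
    (hlow : ∀ p ∈ S, y₀ * W < p.2) (hup : ∀ p ∈ S, (p.2 : ℝ) ≤ y₀ * W')
    (hterm : ∀ p ∈ S, ∃ J, W' ^ (2 * s) / W ^ n ≤ |f.coeff J| * ((p.1 : ℝ) / p.2) ^ J) :
    #S ≤ 2 * s + 3 := by
  have hY : 0 < y₀ * W := mul_pos (one_pos.trans_le hy₀.one_le) hW
  refine card_le_of_subset_smallPairs hf.card_support hf.natDegree_le (hf.natDegree_ne_zero hn) hm
    hY hS hpos hle hlow hup fun p hp => ?_
  obtain ⟨J, hJ⟩ := hterm p hp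
  exact ⟨J, (hy₀.div_pow_mul_max_pow_lt hW hW').trans_le hJ⟩

theorem IsSparse.card_first_level_le (hf : IsSparse n s H f) (hn : 0 < n) (hsn : 2 * s ≤ n)
    (hm : 0 < m) (hy₀ : IsGapThreshold n s m y₀) (hW : 1 ≤ W) (hWH : W ^ (2 * n) ≤ H)
    (hS : ↑S ⊆ smallPairs n f m) (hlow : ∀ p ∈ S, y₀ < p.1) (hle : ∀ p ∈ S, p.1 ≤ p.2)
    (hup : ∀ p ∈ S, (p.2 : ℝ) ≤ y₀ * W) : #S ≤ 2 * s + 3 := by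
  have hy₀pos : 0 < y₀ := one_pos.trans_le hy₀.one_le
  have hWpos : 0 < W := one_pos.trans_le hW
  have hpos : ∀ p ∈ S, (0 : ℝ) < p.1 := fun p hp => hy₀pos.trans (hlow p hp)
  obtain ⟨J, hJn, hJ⟩ := hf.exists_le_abs_coeff
  refine hf.card_level_le hn hm hy₀ one_pos hW hS (fun p hp => by exact_mod_cast hpos p hp) hle
    (fun p hp => ?_) hup fun p hp => ⟨J, ?_⟩
  · rw [mul_one]
    exact (hlow p hp).trans_le (by exact_mod_cast hle p hp)
  · have hratio : 1 / W ≤ (p.1 : ℝ) / p.2 := by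
      have hy : (0 : ℝ) < p.2 := (hpos p hp).trans_le (by exact_mod_cast hle p hp)
      rw [div_le_div_iff₀ hWpos hy, one_mul]
      exact (hup p hp).trans (by gcongr; exact (hlow p hp).le)
    calc W ^ (2 * s) / 1 ^ n ≤ W ^ n := by
          rw [one_pow, div_one]
          exact pow_le_pow_right₀ hW hsn
      _ = W ^ (2 * n) * (1 / W) ^ n := by
          rw [two_mul, pow_add, mul_assoc, ← mul_pow, mul_one_div_cancel hWpos.ne', one_pow,
            mul_one]
      _ ≤ |f.coeff J| * (1 / W) ^ J :=
          mul_le_mul (hWH.trans hJ)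
            (pow_le_pow_of_le_one (by positivity) (by rwa [div_le_one hWpos]) hJn)
            (by positivity) (abs_nonneg _)
      _ ≤ |f.coeff J| * ((p.1 : ℝ) / p.2) ^ J := by gcongr

theorem IsSparse.card_next_level_le (hf : IsSparse n s H f) (hn : 0 < n)
    (hm : 0 < m) (hy₀ : IsGapThreshold n s m y₀) (hW : 1 ≤ W) (hW' : 1 ≤ W')
    (hWW' : W' ^ (2 * s) ≤ W ^ n) (hS : ↑S ⊆ smallPairs n f m) (hlow : ∀ p ∈ S, y₀ < p.1)
    (hle : ∀ p ∈ S, p.1 ≤ p.2) (hlow' : ∀ p ∈ S, y₀ * W < p.2)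
    (hup : ∀ p ∈ S, (p.2 : ℝ) ≤ y₀ * W') : #S ≤ 2 * s + 3 := by
  have hpos : ∀ p ∈ S, (0 : ℝ) < p.1 := fun p hp =>
    (one_pos.trans_le hy₀.one_le).trans (hlow p hp)
  have hWpos : 0 < W := one_pos.trans_le hW
  refine hf.card_level_le hn hm hy₀ hWpos hW' hS (fun p hp => by exact_mod_cast hpos p hp) hle
    hlow' hup fun p _ => ⟨0, ?_⟩
  rw [pow_zero, mul_one]
  exact ((div_le_one (pow_pos hWpos n)).mpr hWW').trans hf.one_le_abs_coeff_zero

theorem IsSparse.card_le_of_levels (hf : IsSparse n s H f) (hn : 0 < n) (hsn : 2 * s ≤ n)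
    (hm : 0 < m) (hy₀ : IsGapThreshold n s m y₀) {W : ℕ → ℝ} (hW : ∀ k, 1 ≤ W k)
    (hW₀ : W 0 ^ (2 * n) ≤ H) (hstep : ∀ k, W (k + 1) ^ (2 * s) ≤ W k ^ n) (L : ℕ)
    (hS : ↑S ⊆ smallPairs n f m) (hlow : ∀ p ∈ S, y₀ < p.1) (hle : ∀ p ∈ S, p.1 ≤ p.2)
    (hup : ∀ p ∈ S, (p.2 : ℝ) ≤ y₀ * W L) : #S ≤ (2 * s + 3) * (L + 1) := by
  induction L generalizing S with
  | zero => simpa using hf.card_first_level_le hn hsn hm hy₀ (hW 0) hW₀ hS hlow hle hup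
  | succ L ih =>
    have hbelow : #{p ∈ S | (p.2 : ℝ) ≤ y₀ * W L} ≤ (2 * s + 3) * (L + 1) :=
      ih (fun p hp => hS (mem_filter.mp hp).1) (fun p hp => hlow p (mem_filter.mp hp).1)
        (fun p hp => hle p (mem_filter.mp hp).1) fun p hp => (mem_filter.mp hp).2
    have habove : #{p ∈ S | ¬(p.2 : ℝ) ≤ y₀ * W L} ≤ 2 * s + 3 :=
      hf.card_next_level_le hn hm hy₀ (hW L) (hW (L + 1)) (hstep L)
        (fun p hp => hS (mem_filter.mp hp).1) (fun p hp => hlow p (mem_filter.mp hp).1)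
        (fun p hp => hle p (mem_filter.mp hp).1) (fun p hp => not_le.mp (mem_filter.mp hp).2)
        fun p hp => hup p (mem_filter.mp hp).1
    rw [← card_filter_add_card_filter_not (s := S) fun p => (p.2 : ℝ) ≤ y₀ * W L]
    linarith

theorem IsSparse.card_le_of_le (hf : IsSparse n s H f) (hn : 0 < n) (hsn : 2 * s ≤ n)
    (hH : 1 ≤ H) (hm : 0 < m) (hy₀ : IsGapThreshold n s m y₀) (L : ℕ)
    (hS : ↑S ⊆ smallPairs n f m) (hlow : ∀ p ∈ S, y₀ < p.1) (hle : ∀ p ∈ S, p.1 ≤ p.2)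
    (hup : ∀ p ∈ S, (p.2 : ℝ) ≤ y₀ * H ^ ((n / (2 * s) : ℝ) ^ L / (2 * n))) :
    #S ≤ (2 * s + 3) * (L + 1) := by
  have hH0 : 0 ≤ H := zero_le_one.trans hH
  have hnR : (n : ℝ) ≠ 0 := by positivity
  have hsR : (s : ℝ) ≠ 0 := Nat.cast_ne_zero.mpr (hf.pos hn).ne'
  refine hf.card_le_of_levels hn hsn hm hy₀ (W := fun k => H ^ ((n / (2 * s) : ℝ) ^ k / (2 * n)))
    (fun k => Real.one_le_rpow hH (by positivity)) ?_ (fun k => ?_) L hS hlow hle hup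
  · rw [← Real.rpow_mul_natCast hH0]
    refine (Real.rpow_le_rpow_of_exponent_le hH ?_).trans_eq (Real.rpow_one H)
    push_cast
    field_simp
    rfl
  · rw [← Real.rpow_mul_natCast hH0, ← Real.rpow_mul_natCast hH0]
    refine (congrArg (H ^ ·) ?_).le
    push_cast
    rw [pow_succ]
    field_simp

theorem IsSparse.card_smallPairs_le (hf : IsSparse n s H f) (hn : 0 < n) (hsn : 2 * s ≤ n)
    (hH : 1 ≤ H) (hm : 0 < m) (hy₀ : IsGapThreshold n s m y₀) (L : ℕ)
    (hS : ↑S ⊆ smallPairs n f m) (hlow : ∀ p ∈ S, y₀ < p.1 ∧ y₀ < p.2)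
    (hup : ∀ p ∈ S, (p.1 : ℝ) ≤ y₀ * H ^ ((n / (2 * s) : ℝ) ^ L / (2 * n)) ∧
      (p.2 : ℝ) ≤ y₀ * H ^ ((n / (2 * s) : ℝ) ^ L / (2 * n))) :
    #S ≤ 2 * ((2 * s + 3) * (L + 1)) := by
  have hpos : ∀ p ∈ S, p.1 ≠ 0 ∧ p.2 ≠ 0 := fun p hp => by
    have := one_pos.trans_le hy₀.one_le
    exact ⟨Nat.cast_ne_zero.mp (this.trans (hlow p hp).1).ne',
      Nat.cast_ne_zero.mp (this.trans (hlow p hp).2).ne'⟩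
  have hbelow : #{p ∈ S | p.1 ≤ p.2} ≤ (2 * s + 3) * (L + 1) :=
    hf.card_le_of_le hn hsn hH hm hy₀ L (fun p hp => hS (mem_filter.mp hp).1)
      (fun p hp => (hlow p (mem_filter.mp hp).1).1) (fun p hp => (mem_filter.mp hp).2)
      fun p hp => (hup p (mem_filter.mp hp).1).2
  have habove : #{p ∈ S | ¬p.1 ≤ p.2} ≤ (2 * s + 3) * (L + 1) := by
    rw [← card_image_of_injective _ Prod.swap_injective]
    refine hf.reflect.card_le_of_le hn hsn hH hm hy₀ L ?_ ?_ ?_ ?_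
    · intro q hq
      obtain ⟨p, hp, rfl⟩ := mem_image.mp hq
      have hpS := (mem_filter.mp hp).1
      exact swap_mem_smallPairs hf.natDegree_le (hpos p hpS).1 (hpos p hpS).2 (hS hpS)
    · exact forall_mem_image.mpr fun p hp => (hlow p (mem_filter.mp hp).1).2
    · exact forall_mem_image.mpr fun p hp => (not_le.mp (mem_filter.mp hp).2).le
    · exact forall_mem_image.mpr fun p hp => (hup p (mem_filter.mp hp).1).1
  rw [← card_filter_add_card_filter_not (s := S) fun p => p.1 ≤ p.2]
  linarith

end Levels

section Forms

theorem X_dvd_of_forall_mem_support {σ R : Type*} [CommSemiring R] {F : MvPolynomial σ R} {i : σ}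
    (h : ∀ d ∈ F.support, d i ≠ 0) : MvPolynomial.X i ∣ F := by
  rw [F.as_sum]
  exact dvd_sum fun d hd => MvPolynomial.X_dvd_monomial.mpr (Or.inr (h d hd))

theorem not_X_dvd_of_irreducible_map {σ R K : Type*} [CommSemiring R] [CommRing K] [IsDomain K]
    {φ : R →+* K} {F : MvPolynomial σ R} {n : ℕ} (hF : F.IsHomogeneous n) (hn : 2 ≤ n)
    (hirr : Irreducible (MvPolynomial.map φ F)) (i : σ) : ¬MvPolynomial.X i ∣ F := by
  intro hdvd
  have hdvd' : MvPolynomial.X i ∣ MvPolynomial.map φ F := by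
    simpa only [MvPolynomial.map_X] using map_dvd (MvPolynomial.map φ) hdvd
  have hassoc : Associated (MvPolynomial.X i) (MvPolynomial.map φ F) :=
    MvPolynomial.X_prime.irreducible.associated_of_dvd hirr hdvd'
  have hdegree : (MvPolynomial.map φ F).totalDegree ≤ 1 :=
    (MvPolynomial.totalDegree_le_of_dvd_of_isDomain hassoc.symm.dvd
      (MvPolynomial.X_ne_zero i)).trans_eq (MvPolynomial.totalDegree_X i)
  rw [(hF.map φ).totalDegree hirr.ne_zero] at hdegree
  omega

variable {n s m : ℕ} {F : MvPolynomial (Fin 2) ℤ}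

theorem natDegree_dehomogenize_le (hF : F.IsHomogeneous n) : (dehomogenize F).natDegree ≤ n := by
  have hdegree : ∀ i, ((![X, 1] : Fin 2 → ℤ[X]) i).natDegree ≤ 1 := by
    intro i
    fin_cases i <;> simp
  exact (MvPolynomial.aeval_natDegree_le F hF.totalDegree_le _ hdegree).trans_eq (mul_one n)

theorem homogenize_dehomogenize (hF : F.IsHomogeneous n) : (dehomogenize F).homogenize n = F :=
  homogenize_eq_of_isHomogeneous hF rfl

theorem coeff_eq_coeff_dehomogenize (hF : F.IsHomogeneous n) {d : Fin 2 →₀ ℕ} (hd : d 0 + d 1 = n) :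
    F.coeff d = (dehomogenize F).coeff (d 0) := by
  conv_lhs => rw [← homogenize_dehomogenize hF]
  rw [coeff_homogenize, if_pos hd]

theorem add_eq_of_mem_support (hF : F.IsHomogeneous n) {d : Fin 2 →₀ ℕ} (hd : d ∈ F.support) :
    d 0 + d 1 = n := by
  by_contra h
  rw [← homogenize_dehomogenize hF, MvPolynomial.mem_support_iff, coeff_homogenize, if_neg h] at hd
  exact hd rfl

theorem exists_coeff_eq_coeff_dehomogenize (hF : F.IsHomogeneous n) {j : ℕ} (hj : j ≤ n) :
    ∃ d : Fin 2 →₀ ℕ, d 0 = j ∧ F.coeff d = (dehomogenize F).coeff j := by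
  refine ⟨Finsupp.single 0 j + Finsupp.single 1 (n - j), by simp, ?_⟩
  rw [coeff_eq_coeff_dehomogenize hF] <;> simp [Nat.add_sub_cancel' hj]

theorem support_dehomogenize (hF : F.IsHomogeneous n) :
    (dehomogenize F).support = F.support.image (· 0) := by
  ext j
  rw [mem_image]
  constructor
  · intro hj
    obtain ⟨d, hdj, hd⟩ := exists_coeff_eq_coeff_dehomogenize hF
      ((le_natDegree_of_mem_supp j hj).trans (natDegree_dehomogenize_le hF))
    exact ⟨d, MvPolynomial.mem_support_iff.mpr (hd ▸ mem_support_iff.mp hj), hdj⟩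
  · rintro ⟨d, hd, rfl⟩
    rw [mem_support_iff, ← coeff_eq_coeff_dehomogenize hF (add_eq_of_mem_support hF hd)]
    exact MvPolynomial.mem_support_iff.mp hd

theorem card_support_dehomogenize (hF : F.IsHomogeneous n) :
    #(dehomogenize F).support = #F.support := by
  rw [support_dehomogenize hF]
  refine card_image_of_injOn fun d hd d' hd' h => ?_
  have := add_eq_of_mem_support hF hd
  have := add_eq_of_mem_support hF hd'
  ext i
  fin_cases i
  · exact h
  · have : d 0 = d' 0 := h
    change d 1 = d' 1
    omega

theorem abs_coeff_dehomogenize_le_height (hF : F.IsHomogeneous n) {j : ℕ} (hj : j ≤ n) :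
    |(dehomogenize F).coeff j| ≤ height F := by
  obtain ⟨d, -, hd⟩ := exists_coeff_eq_coeff_dehomogenize hF hj
  rw [← hd, Int.abs_eq_natAbs, Nat.cast_le]
  by_cases hmem : d ∈ F.support
  · exact le_sup (f := fun d => (F.coeff d).natAbs) hmem
  · rw [MvPolynomial.notMem_support_iff.mp hmem]
    exact Nat.zero_le _

theorem exists_abs_coeff_dehomogenize_eq_height (hF : F.IsHomogeneous n) (hF0 : F ≠ 0) :
    ∃ J ≤ n, |(dehomogenize F).coeff J| = height F := by
  obtain ⟨d, hd, hheight⟩ := exists_mem_eq_sup F.support (MvPolynomial.support_nonempty.mpr hF0)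
    fun d => (F.coeff d).natAbs
  have hdn := add_eq_of_mem_support hF hd
  refine ⟨d 0, by omega, ?_⟩
  rw [← coeff_eq_coeff_dehomogenize hF hdn, Int.abs_eq_natAbs, height, hheight]

theorem coeff_zero_dehomogenize_ne_zero (hF : F.IsHomogeneous n) (hX : ¬MvPolynomial.X 0 ∣ F) :
    (dehomogenize F).coeff 0 ≠ 0 := by
  contrapose! hX
  refine X_dvd_of_forall_mem_support fun d hd h₀ => MvPolynomial.mem_support_iff.mp hd ?_
  rw [coeff_eq_coeff_dehomogenize hF (add_eq_of_mem_support hF hd), h₀, hX]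

theorem coeff_top_dehomogenize_ne_zero (hF : F.IsHomogeneous n) (hX : ¬MvPolynomial.X 1 ∣ F) :
    (dehomogenize F).coeff n ≠ 0 := by
  contrapose! hX
  refine X_dvd_of_forall_mem_support fun d hd h₁ => MvPolynomial.mem_support_iff.mp hd ?_
  have hdn := add_eq_of_mem_support hF hd
  rw [coeff_eq_coeff_dehomogenize hF hdn, show d 0 = n by omega, hX]

theorem isSparse_map_dehomogenize (hF : F.IsHomogeneous n) (hX : ∀ i, ¬MvPolynomial.X i ∣ F)
    (hcard : #F.support = s + 1) :
    IsSparse n s (height F) ((dehomogenize F).map (Int.castRingHom ℝ)) where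
  natDegree_le := natDegree_map_le.trans (natDegree_dehomogenize_le hF)
  card_support := by
    rw [support_map_of_injective _ (Int.castRingHom ℝ).injective_int, card_support_dehomogenize hF,
      hcard]
  one_le_abs_coeff_zero := by
    rw [coeff_map, eq_intCast]
    exact_mod_cast Int.one_le_abs (coeff_zero_dehomogenize_ne_zero hF (hX 0))
  one_le_abs_coeff_top := by
    rw [coeff_map, eq_intCast]
    exact_mod_cast Int.one_le_abs (coeff_top_dehomogenize_ne_zero hF (hX 1))
  exists_le_abs_coeff := by
    have hF0 : F ≠ 0 := fun h => hX 0 (h ▸ dvd_zero _)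
    obtain ⟨J, hJ, hheight⟩ := exists_abs_coeff_dehomogenize_eq_height hF hF0
    refine ⟨J, hJ, ?_⟩
    rw [coeff_map, eq_intCast]
    exact_mod_cast hheight.ge

theorem cast_eval_eq_pow_mul_eval_div (hF : F.IsHomogeneous n) (x : ℤ) {y : ℤ} (hy : y ≠ 0) :
    (MvPolynomial.eval ![x, y] F : ℝ) =
      y ^ n * ((dehomogenize F).map (Int.castRingHom ℝ)).eval ((x : ℝ) / y) := by
  have hcoord : Int.castRingHom ℝ ∘ ![x, y] = ![(x : ℝ), (y : ℝ)] := by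
    ext i
    fin_cases i <;> rfl
  have hcast : Int.castRingHom ℝ (MvPolynomial.eval ![x, y] F) =
      MvPolynomial.eval ![(x : ℝ), (y : ℝ)] (MvPolynomial.map (Int.castRingHom ℝ) F) := by
    rw [MvPolynomial.eval₂_comp, hcoord, MvPolynomial.eval_map]
  have heval := eval_homogenize
    (natDegree_map_le (f := Int.castRingHom ℝ).trans (natDegree_dehomogenize_le hF))
    ![(x : ℝ), (y : ℝ)] (Int.cast_ne_zero.mpr hy)
  rw [homogenize_map, homogenize_dehomogenize hF] at heval
  rw [← eq_intCast (Int.castRingHom ℝ), hcast, heval, mul_comm]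
  rfl

theorem natAbs_mem_smallPairs (hF : F.IsHomogeneous n) {p : ℤ × ℤ} (hp : p.2 ≠ 0)
    (hgcd : Int.gcd p.1 p.2 = 1) (hval : |MvPolynomial.eval ![p.1, p.2] F| ≤ m) :
    (p.1.natAbs, p.2.natAbs) ∈ smallPairs n ((dehomogenize F).map (Int.castRingHom ℝ)) m ∨
      (p.1.natAbs, p.2.natAbs) ∈
        smallPairs n (((dehomogenize F).map (Int.castRingHom ℝ)).comp (-X)) m := by
  have hvalR : |(MvPolynomial.eval ![p.1, p.2] F : ℝ)| ≤ m := by exact_mod_cast hval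
  rw [cast_eval_eq_pow_mul_eval_div hF p.1 hp, abs_mul, abs_pow] at hvalR
  have hratio : (p.1.natAbs : ℝ) / p.2.natAbs = |(p.1 : ℝ) / p.2| := by
    rw [abs_div, Nat.cast_natAbs, Nat.cast_natAbs, Int.cast_abs, Int.cast_abs]
  have habs : |(p.2.natAbs : ℝ)| = |(p.2 : ℝ)| := by
    rw [Nat.abs_cast, Nat.cast_natAbs, Int.cast_abs]
  rcases abs_choice ((p.1 : ℝ) / p.2) with h | h
  · refine Or.inl ⟨hgcd, ?_⟩
    rwa [hratio, h, abs_mul, abs_pow, habs]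
  · refine Or.inr ⟨hgcd, ?_⟩
    rwa [hratio, h, eval_comp, eval_neg, eval_X, neg_neg, abs_mul, abs_pow, habs]

theorem card_le_four_mul_card_image_natAbs (S : Finset (ℤ × ℤ)) :
    #S ≤ 4 * #(S.image fun p => (p.1.natAbs, p.2.natAbs)) := by
  refine card_le_mul_card_image _ _ fun q _ => ?_
  have hfibre : {p ∈ S | (p.1.natAbs, p.2.natAbs) = q} ⊆
      ({(q.1 : ℤ), -(q.1 : ℤ)} : Finset ℤ) ×ˢ ({(q.2 : ℤ), -(q.2 : ℤ)} : Finset ℤ) := by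
    intro p hp
    obtain rfl := (mem_filter.mp hp).2
    simp only [mem_product, mem_insert, mem_singleton]
    exact ⟨p.1.natAbs_eq, p.2.natAbs_eq⟩
  refine (card_le_card hfibre).trans ?_
  rw [card_product]
  exact Nat.mul_le_mul card_le_two card_le_two

theorem card_solutions_le (hF : F.IsHomogeneous n) (hX : ∀ i, ¬MvPolynomial.X i ∣ F)
    (hcard : #F.support = s + 1) (hn : 0 < n) (hsn : 2 * s ≤ n) (hm : 0 < m)
    (hH : 0 < height F) {y₀ : ℝ} (hy₀ : IsGapThreshold n s m y₀) (L : ℕ) {S : Finset (ℤ × ℤ)}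
    (hgcd : ∀ p ∈ S, Int.gcd p.1 p.2 = 1)
    (hval : ∀ p ∈ S, |MvPolynomial.eval ![p.1, p.2] F| ≤ (m : ℤ))
    (hlow : ∀ p ∈ S, y₀ < ((min |p.1| |p.2| : ℤ) : ℝ))
    (hup : ∀ p ∈ S, ((max |p.1| |p.2| : ℤ) : ℝ) ≤
      y₀ * (height F : ℝ) ^ ((n / (2 * s) : ℝ) ^ L / (2 * n))) :
    #S ≤ 16 * ((2 * s + 3) * (L + 1)) := by
  classical
  set f := (dehomogenize F).map (Int.castRingHom ℝ)
  have hf : IsSparse n s (height F) f := isSparse_map_dehomogenize hF hX hcard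
  set U := S.image fun p => (p.1.natAbs, p.2.natAbs)
  have hlowU : ∀ u ∈ U, y₀ < u.1 ∧ y₀ < u.2 := forall_mem_image.mpr fun p hp => by
    simpa only [Int.abs_eq_natAbs, Int.cast_min, lt_min_iff, Int.cast_natCast] using hlow p hp
  have hupU : ∀ u ∈ U, (u.1 : ℝ) ≤ y₀ * (height F : ℝ) ^ ((n / (2 * s) : ℝ) ^ L / (2 * n)) ∧
      (u.2 : ℝ) ≤ y₀ * (height F : ℝ) ^ ((n / (2 * s) : ℝ) ^ L / (2 * n)) :=
    forall_mem_image.mpr fun p hp => by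
      simpa only [Int.abs_eq_natAbs, Int.cast_max, max_le_iff, Int.cast_natCast] using hup p hp
  have hsmall : ∀ u ∈ U, u ∈ smallPairs n f m ∨ u ∈ smallPairs n (f.comp (-X)) m :=
    forall_mem_image.mpr fun p hp => by
      refine natAbs_mem_smallPairs hF ?_ (hgcd p hp) (hval p hp)
      have hpos := (one_pos.trans_le hy₀.one_le).trans (hlowU _ (mem_image_of_mem _ hp)).2
      exact Int.natAbs_ne_zero.mp (Nat.cast_pos.mp hpos).ne'
  have hcount : ∀ g : ℝ[X], IsSparse n s (height F) g →
      #{u ∈ U | u ∈ smallPairs n g m} ≤ 2 * ((2 * s + 3) * (L + 1)) := fun g hg =>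
    hg.card_smallPairs_le hn hsn (Nat.one_le_cast.mpr hH) (Nat.cast_pos.mpr hm) hy₀ L
      (fun u hu => (mem_filter.mp hu).2) (fun u hu => hlowU u (mem_filter.mp hu).1)
      fun u hu => hupU u (mem_filter.mp hu).1
  have hU : #U ≤ 4 * ((2 * s + 3) * (L + 1)) := by
    have hcover := card_le_card (filter_true_of_mem hsmall).ge
    rw [filter_or] at hcover
    have := hcover.trans (card_union_le _ _)
    linarith [hcount f hf, hcount _ hf.comp_neg_X]
  linarith [card_le_four_mul_card_image_natAbs S]

theorem mahler_le (hF : F.IsHomogeneous n) : mahler F ≤ (n + 1) * height F := by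
  calc mahler F
      ≤ ∑ j ∈ range (n + 1), ‖((dehomogenize F).map (Int.castRingHom ℂ)).coeff j‖ :=
        (mahlerMeasure_le_sum_norm_coeff _).trans_eq (sum_over_range' _ (fun _ => norm_zero) _
          (Nat.lt_succ_of_le (natDegree_map_le.trans (natDegree_dehomogenize_le hF))))
    _ ≤ ∑ _ ∈ range (n + 1), (height F : ℝ) := by
        refine sum_le_sum fun _ hj => ?_
        rw [coeff_map, eq_intCast, Complex.norm_intCast]
        exact_mod_cast abs_coeff_dehomogenize_le_height hF (Nat.lt_succ_iff.mp (mem_range.mp hj))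
    _ = (n + 1) * height F := by simp

theorem mahler_nonneg (F : MvPolynomial (Fin 2) ℤ) : 0 ≤ mahler F := mahlerMeasure_nonneg _

theorem equivalent_self (F : MvPolynomial (Fin 2) ℤ) : Equivalent F F := by
  refine ⟨1, Or.inl ?_⟩
  rw [subst]
  conv_lhs => rw [← MvPolynomial.aeval_X_left_apply F]
  congr 2
  ext1 i
  fin_cases i <;> simp

theorem minMahler_nonneg (F : MvPolynomial (Fin 2) ℤ) : 0 ≤ minMahler F := by
  refine Real.sInf_nonneg ?_
  rintro _ ⟨G, -, rfl⟩
  exact mahler_nonneg G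

theorem minMahler_le_mahler (F : MvPolynomial (Fin 2) ℤ) : minMahler F ≤ mahler F := by
  refine csInf_le ⟨0, ?_⟩ ⟨F, equivalent_self F, rfl⟩
  rintro _ ⟨G, -, rfl⟩
  exact mahler_nonneg G

theorem log_minMahler_le (hF : F.IsHomogeneous n) (hH : 0 < height F) :
    Real.log (minMahler F) ≤ n + Real.log (height F) := by
  have hHR : (1 : ℝ) ≤ height F := by exact_mod_cast hH
  rcases (minMahler_nonneg F).eq_or_lt with h | h
  · rw [← h, Real.log_zero]
    have := Real.log_nonneg hHR
    positivity
  · calc Real.log (minMahler F) ≤ Real.log ((n + 1) * height F) :=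
          Real.log_le_log h ((minMahler_le_mahler F).trans (mahler_le hF))
      _ = Real.log (n + 1) + Real.log (height F) := Real.log_mul (by positivity) (by positivity)
      _ ≤ n + Real.log (height F) := by
          linarith [Real.log_le_sub_one_of_pos (show (0 : ℝ) < n + 1 by positivity)]

end Forms

section Parameters

variable {n s m : ℕ} {a b : ℝ} {F : MvPolynomial (Fin 2) ℤ}

theorem one_le_log (hn : 3 ≤ n) : 1 ≤ Real.log n := by
  have hnR : (3 : ℝ) ≤ n := by exact_mod_cast hn
  rw [Real.le_log_iff_exp_le (by linarith)]
  linarith [Real.exp_one_lt_three]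

theorem le_bigR (hn : 3 ≤ n) : (n : ℝ) ≤ bigR n := by
  have hnR : (1 : ℝ) ≤ n := by exact_mod_cast (by omega : 1 ≤ n)
  refine Real.self_le_rpow_of_one_le hnR ?_
  nlinarith [one_le_log hn]

theorem YS_pow (hsn : 2 * s < n) :
    YS n s m ^ (n - 2 * s) = (Real.exp 6 * s) ^ n * bigR n ^ (2 * s) * m := by
  have hR : 0 ≤ bigR n := Real.rpow_nonneg n.cast_nonneg _
  have hcast : (n : ℝ) - 2 * s = (n - 2 * s : ℕ) := by
    rw [Nat.cast_sub hsn.le]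
    push_cast
    rfl
  rw [YS, hcast, one_div, Real.rpow_inv_natCast_pow (by positivity) (by omega)]

theorem eight_mul_pow_lt_exp_six_mul_pow (hs : 0 < s) (hsn : s ≤ n) :
    (8 * s : ℝ) ^ s < (Real.exp 6 * s) ^ n := by
  have hsR : (1 : ℝ) ≤ s := by exact_mod_cast hs
  have hexp : (8 : ℝ) < Real.exp 6 := by
    have := Real.quadratic_le_exp_of_nonneg (show (0 : ℝ) ≤ 6 by norm_num)
    linarith
  calc (8 * s : ℝ) ^ s ≤ (8 * s) ^ n := pow_le_pow_right₀ (by linarith) hsn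
    _ < (Real.exp 6 * s) ^ n := by gcongr; omega

theorem mul_eight_mul_pow_lt_YS_pow (hs : 0 < s) (hsn : 3 * s ≤ n) (hm : 0 < m) :
    m * (8 * s : ℝ) ^ s < YS n s m ^ (n - 2 * s) := by
  have hR : 1 ≤ bigR n :=
    (Nat.one_le_cast.mpr (by omega)).trans (le_bigR (by omega : 3 ≤ n))
  rw [YS_pow (by omega), mul_comm]
  gcongr
  exact (eight_mul_pow_lt_exp_six_mul_pow hs (by omega)).trans_le
    (le_mul_of_one_le_right (by positivity) (one_le_pow₀ hR))

theorem mul_four_mul_degree_pow_lt_YS_pow (hs : 0 < s) (hsn : 3 * s ≤ n) (hm : 0 < m) :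
    m * (4 * n : ℝ) ^ s < YS n s m ^ (n - 2 * s) := by
  have hsR : (1 : ℝ) ≤ s := by exact_mod_cast hs
  have hnR := le_bigR (by omega : 3 ≤ n)
  have hR : 1 ≤ bigR n := (Nat.one_le_cast.mpr (by omega)).trans hnR
  have hfour : (4 : ℝ) ^ s < (Real.exp 6 * s) ^ n :=
    (pow_le_pow_left₀ (by norm_num) (by linarith) s).trans_lt
      (eight_mul_pow_lt_exp_six_mul_pow hs (by omega))
  have hdegree : (n : ℝ) ^ s ≤ bigR n ^ (2 * s) :=
    (pow_le_pow_left₀ n.cast_nonneg hnR s).trans (pow_le_pow_right₀ hR (by omega))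
  rw [YS_pow (by omega), mul_comm, mul_pow]
  gcongr ?_ * _
  exact mul_lt_mul hfour hdegree (pow_pos (Nat.cast_pos.mpr (by omega)) s) (by positivity)

theorem one_le_YS (hs : 0 < s) (hsn : 3 * s ≤ n) (hm : 0 < m) : 1 ≤ YS n s m := by
  have hsR : (1 : ℝ) ≤ s := by exact_mod_cast hs
  have hY : 0 ≤ YS n s m := by
    unfold YS bigR
    positivity
  refine (one_le_pow_iff_of_nonneg hY (by omega : n - 2 * s ≠ 0)).mp ?_
  exact (one_le_mul_of_one_le_of_one_le (Nat.one_le_cast.mpr hm)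
    (one_le_pow₀ (by linarith))).trans (mul_eight_mul_pow_lt_YS_pow hs hsn hm).le

theorem isGapThreshold_YS (hs : 0 < s) (hsn : 3 * s ≤ n) (hm : 0 < m) :
    IsGapThreshold n s m (YS n s m) where
  one_le := one_le_YS hs hsn hm
  mul_degree_pow_lt := (mul_four_mul_degree_pow_lt_YS_pow hs hsn hm).trans_le
    (pow_le_pow_right₀ (one_le_YS hs hsn hm) (Nat.sub_le _ _))
  mul_pow_lt := by
    have hY := one_le_YS hs hsn hm
    rw [← Nat.sub_add_cancel (by omega : 2 * s ≤ n), pow_add, Nat.sub_add_cancel (by omega)]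
    gcongr
    exact mul_eight_mul_pow_lt_YS_pow hs hsn hm

theorem mul_lam_le {k : ℕ} (hb : b ≤ 1) (hkn : k ≤ n) : k * lam a b n ≤ n * lam a b k := by
  have hknR : (k : ℝ) ≤ n := by exact_mod_cast hkn
  have : 0 ≤ 1 - b := by linarith
  have hsqrt : k * Real.sqrt (2 * (n + a ^ 2)) ≤ n * Real.sqrt (2 * (k + a ^ 2)) := by
    refine abs_le_of_sq_le_sq' ?_ (by positivity) |>.2
    rw [mul_pow, mul_pow, Real.sq_sqrt (by positivity), Real.sq_sqrt (by positivity)]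
    have hsq : (k : ℝ) ^ 2 * a ^ 2 ≤ n ^ 2 * a ^ 2 := by gcongr
    have hmix : (k * n : ℝ) * k ≤ k * n * n := by gcongr
    linarith
  unfold lam
  rw [← mul_div_assoc, ← mul_div_assoc]
  gcongr

theorem lam_nonneg (hb : b ≤ 1) : 0 ≤ lam a b n :=
  div_nonneg (Real.sqrt_nonneg _) (sub_nonneg.mpr hb)

theorem lam_three : lam a b 3 = Real.sqrt 2 * Real.sqrt (3 + a ^ 2) / (1 - b) := by
  rw [lam, Real.sqrt_mul (by norm_num)]
  norm_num

theorem bigC_pos (hn : 0 < n) (hm : 0 < m) (hH : 0 < height F) : 0 < bigC F n m := by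
  unfold bigC bigR
  positivity

theorem log_bigC (hn : 0 < n) (hm : 0 < m) (hH : 0 < height F) :
    Real.log (bigC F n m) = 800 * Real.log n ^ 3 + Real.log m +
      n * (Real.log 2 + Real.log (height F) + Real.log (n * (n + 1)) / 2) := by
  have hR : 0 < bigR n := Real.rpow_pos_of_pos (by positivity) _
  rw [bigC, Real.log_mul (by positivity) (by positivity), Real.log_mul hR.ne' (by positivity),
    Real.log_pow, Real.log_mul (by positivity) (by positivity),
    Real.log_mul (by norm_num) (by positivity), Real.log_sqrt (by positivity), bigR,
    Real.log_rpow (by positivity)]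
  ring

theorem log_two_mul_bigC_le (hn : 3 ≤ n) (hm : 0 < m) (hH : 0 < height F) :
    Real.log (2 * bigC F n m) ≤
      802 * n * (Real.log (height F) + n ^ 2 + Real.log m / n) := by
  have hnR : (3 : ℝ) ≤ n := by exact_mod_cast hn
  have : 0 ≤ Real.log (height F) := Real.log_natCast_nonneg _
  have hlogm : 0 ≤ Real.log m := Real.log_natCast_nonneg _
  have hlog2 : Real.log 2 ≤ 1 := by linarith [Real.log_two_lt_d9]
  have hlogn : Real.log n ^ 3 ≤ n ^ 3 := by
    have := Real.log_le_self n.cast_nonneg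
    have := Real.log_natCast_nonneg n
    gcongr
  have hlogn1 : Real.log (n * (n + 1)) / 2 ≤ n := by
    rw [Real.log_mul (by positivity) (by positivity)]
    linarith [Real.log_le_sub_one_of_pos (show (0 : ℝ) < n by positivity),
      Real.log_le_sub_one_of_pos (show (0 : ℝ) < n + 1 by positivity)]
  have hbracket : n * (Real.log 2 + Real.log (height F) + Real.log (n * (n + 1)) / 2) ≤
      n * (1 + Real.log (height F) + n) := by gcongr
  have hcube : 1 + (n : ℝ) + n ^ 2 ≤ 2 * n ^ 3 := by nlinarith [sq_nonneg (n : ℝ)]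
  have hnH : 0 ≤ n * Real.log (height F) := by positivity
  calc Real.log (2 * bigC F n m)
      = Real.log 2 + Real.log (bigC F n m) :=
        Real.log_mul (by norm_num) (bigC_pos (by omega) hm hH).ne'
    _ ≤ 802 * (n * Real.log (height F)) + 802 * n ^ 3 + 802 * Real.log m := by
        rw [log_bigC (by omega) hm hH]
        linarith
    _ = 802 * n * (Real.log (height F) + n ^ 2 + Real.log m / n) := by field_simp

theorem log_four_add_bigA_le (hF : F.IsHomogeneous n) (hn : 3 ≤ n) (hH : 0 < height F) :
    Real.log 4 + bigA a F n ≤ (1 + 1 / a ^ 2) * (Real.log (height F) + n ^ 2) := by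
  have hnR : (3 : ℝ) ≤ n := by exact_mod_cast hn
  have hlogH : 0 ≤ Real.log (height F) := Real.log_natCast_nonneg _
  have hlog4 : Real.log 4 ≤ Real.log (height F) + n ^ 2 := by
    have := Real.log_le_sub_one_of_pos (show (0 : ℝ) < 4 by norm_num)
    nlinarith
  have hmahler : Real.log (minMahler F) + n / 2 ≤ Real.log (height F) + n ^ 2 := by
    nlinarith [log_minMahler_le hF hH]
  have hbigA : bigA a F n ≤ 1 / a ^ 2 * (Real.log (height F) + n ^ 2) := by
    unfold bigA
    gcongr
  linarith

theorem YL_pos (hn : 0 < n) (hm : 0 < m) (hH : 0 < height F) : 0 < YL a b F n m := by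
  have := bigC_pos hn hm hH
  unfold YL
  positivity

theorem log_YL (hn : 0 < n) (hm : 0 < m) (hH : 0 < height F) :
    Real.log (YL a b F n m) =
      (Real.log (2 * bigC F n m) + lam a b n * (Real.log 4 + bigA a F n)) / (n - lam a b n) := by
  have hC := bigC_pos hn hm hH
  rw [YL, Real.log_mul (by positivity) (by positivity), Real.log_rpow (by positivity),
    Real.log_rpow (by positivity), Real.log_mul (by norm_num) (Real.exp_pos _).ne', Real.log_exp]
  ring

theorem log_YL_le (hb : b < 1) (hlam : lam a b 3 < 3) (hF : F.IsHomogeneous n) (hn : 3 ≤ n)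
    (hm : 0 < m) (hH : 0 < height F) :
    Real.log (YL a b F n m) ≤ (803 + 1 / a ^ 2) / (1 - lam a b 3 / 3) *
      (Real.log (height F) + n ^ 2 + Real.log m / n) := by
  set ρ := lam a b 3 / 3 with hρ
  have hρ1 : 0 < 1 - ρ := by linarith
  have hn0 : (0 : ℝ) < n := by exact_mod_cast (by omega : 0 < n)
  have hlamn : lam a b n ≤ ρ * n := by
    have := mul_lam_le (a := a) hb.le hn
    push_cast at this
    linear_combination this / 3
  have hden : (1 - ρ) * n ≤ n - lam a b n := by linarith
  have hlogm : 0 ≤ Real.log m / n := div_nonneg (Real.log_natCast_nonneg _) hn0.le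
  have : 0 ≤ Real.log (height F) := Real.log_natCast_nonneg _
  set T := Real.log (height F) + n ^ 2 + Real.log m / n
  have hbigA : lam a b n * (Real.log 4 + bigA a F n) ≤ n * ((1 + 1 / a ^ 2) * T) := by
    refine mul_le_mul_of_nonneg (hlamn.trans ?_) ?_ (lam_nonneg hb.le) (by positivity)
    · exact mul_le_of_le_one_left hn0.le (by linarith)
    · exact (log_four_add_bigA_le hF hn hH).trans (by gcongr; linarith)
  rw [log_YL (by omega) hm hH, div_le_iff₀ ((by positivity : 0 < (1 - ρ) * n).trans_le hden)]
  calc Real.log (2 * bigC F n m) + lam a b n * (Real.log 4 + bigA a F n)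
      ≤ 802 * n * T + n * ((1 + 1 / a ^ 2) * T) :=
        add_le_add (log_two_mul_bigC_le hn hm hH) hbigA
    _ = (803 + 1 / a ^ 2) / (1 - ρ) * T * ((1 - ρ) * n) := by field_simp; ring
    _ ≤ (803 + 1 / a ^ 2) / (1 - ρ) * T * (n - lam a b n) := by gcongr

end Parameters

section Counting

variable {n s m : ℕ} {a b : ℝ} {F : MvPolynomial (Fin 2) ℤ}

/-- The ratio `log m^{1/n} / log H(F)`, in terms of which the solutions are counted. -/
def logRatio (F : MvPolynomial (Fin 2) ℤ) (n m : ℕ) : ℝ :=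
  Real.log ((m : ℝ) ^ (1 / (n : ℝ))) / Real.log (height F)

theorem logRatio_nonneg (hm : 0 < m) : 0 ≤ logRatio F n m :=
  div_nonneg (Real.log_nonneg (Real.one_le_rpow (Nat.one_le_cast.mpr hm) (by positivity)))
    (Real.log_natCast_nonneg _)

theorem YL_le_height_rpow (hb : b < 1) (hlam : lam a b 3 < 3) (hF : F.IsHomogeneous n) (hn : 3 ≤ n)
    (hm : 0 < m) (hH : 1 < height F) :
    YL a b F n m ≤ (height F : ℝ) ^
      ((803 + 1 / a ^ 2) / (1 - lam a b 3 / 3) * (1 + 2 * n ^ 2 + logRatio F n m)) := by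
  have hHR : (2 : ℝ) ≤ height F := by exact_mod_cast hH
  have hlogH : 1 / 2 ≤ Real.log (height F) := by
    linarith [Real.log_le_log two_pos hHR, Real.log_two_gt_d9]
  have hlogm : Real.log m / n = logRatio F n m * Real.log (height F) := by
    rw [logRatio, div_mul_cancel₀ _ (by linarith), Real.log_rpow (by exact_mod_cast hm)]
    ring
  have hρ : 0 < 1 - lam a b 3 / 3 := by linarith
  rw [Real.le_rpow_iff_log_le (YL_pos (by omega) hm (by omega)) (by linarith)]
  refine (log_YL_le hb hlam hF hn hm (by omega)).trans ?_
  rw [mul_assoc]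
  gcongr
  rw [hlogm]
  nlinarith [sq_nonneg (n : ℝ)]

theorem finite_mediumSolutions (a b : ℝ) (F : MvPolynomial (Fin 2) ℤ) (n s m : ℕ) :
    (mediumSolutions a b F n s m).Finite := by
  refine ((Set.finite_Icc (-⌊YL a b F n m⌋) ⌊YL a b F n m⌋).prod
    (Set.finite_Icc (-⌊YL a b F n m⌋) ⌊YL a b F n m⌋)).subset ?_
  rintro p ⟨-, -, -, hmax⟩
  have hfloor := max_le_iff.mp (Int.le_floor.mpr hmax)
  exact ⟨abs_le.mp hfloor.1, abs_le.mp hfloor.2⟩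

theorem ncard_mediumSolutions_le (hF : F.IsHomogeneous n) (hX : ∀ i, ¬MvPolynomial.X i ∣ F)
    (hcard : #F.support = s + 1) (hs : 0 < s) (hsn : 3 * s ≤ n) (hm : 0 < m)
    (hH : 0 < height F) {L : ℕ}
    (hYL : YL a b F n m ≤ (height F : ℝ) ^ ((n / (2 * s) : ℝ) ^ L / (2 * n))) :
    ((mediumSolutions a b F n s m).ncard : ℝ) ≤ 80 * s * (L + 1) := by
  have hfin := finite_mediumSolutions a b F n s m
  have hmem : ∀ p ∈ hfin.toFinset, p ∈ mediumSolutions a b F n s m := fun p =>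
    hfin.mem_toFinset.mp
  have hreach : YL a b F n m ≤
      YS n s m * (height F : ℝ) ^ ((n / (2 * s) : ℝ) ^ L / (2 * n)) :=
    hYL.trans (le_mul_of_one_le_left (by positivity) (one_le_YS hs hsn hm))
  have hcount := card_solutions_le hF hX hcard (by omega) (by omega) hm hH
    (isGapThreshold_YS hs hsn hm) L (fun p hp => (hmem p hp).1)
    (fun p hp => (hmem p hp).2.1) (fun p hp => (hmem p hp).2.2.1)
    fun p hp => (hmem p hp).2.2.2.trans hreach
  rw [Set.ncard_eq_toFinset_card _ hfin]
  have hfive : 16 * ((2 * s + 3) * (L + 1)) ≤ 80 * s * (L + 1) := by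
    rw [← mul_assoc]
    exact Nat.mul_le_mul_right _ (by omega)
  exact_mod_cast hcount.trans hfive

theorem exists_le_pow_of_one_le {κ Q : ℝ} (hκ : 1 < κ) (hQ : 1 ≤ Q) :
    ∃ L : ℕ, Q ≤ κ ^ L ∧ L ≤ Real.log Q / Real.log κ + 1 := by
  have hlogκ := Real.log_pos hκ
  refine ⟨⌈Real.log Q / Real.log κ⌉₊, ?_, ?_⟩
  · rw [Real.le_pow_iff_log_le (by linarith) (by linarith), ← div_le_iff₀ hlogκ]
    exact Nat.le_ceil _
  · exact (Nat.ceil_lt_add_one (div_nonneg (Real.log_nonneg hQ) hlogκ.le)).le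

theorem log_two_mul_degree_mul_le {K X : ℝ} (hK : 1 ≤ K) (hX : 0 ≤ X) (hn : 3 ≤ n) :
    Real.log (2 * n * (K * (1 + 2 * n ^ 2 + X))) ≤
      (Real.log (2 * K) + 4) * (Real.log n * (1 + X)) := by
  have hnR : (3 : ℝ) ≤ n := by exact_mod_cast hn
  have hpoly : 1 + 2 * (n : ℝ) ^ 2 + X ≤ n ^ 3 * (1 + X) := by
    have hcube : 1 + 2 * (n : ℝ) ^ 2 ≤ n ^ 3 := by nlinarith [sq_nonneg (n : ℝ)]
    have := mul_nonneg (sub_nonneg.mpr (one_le_pow₀ (by linarith) : 1 ≤ (n : ℝ) ^ 3)) hX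
    linarith
  have hlogK : 0 ≤ Real.log (2 * K) := Real.log_nonneg (by linarith)
  have hlogX : Real.log (1 + X) ≤ X := by
    linarith [Real.log_le_sub_one_of_pos (show 0 < 1 + X by linarith)]
  have hlogn := one_le_log hn
  have hlognX : X ≤ Real.log n * X := le_mul_of_one_le_left hX hlogn
  calc Real.log (2 * n * (K * (1 + 2 * n ^ 2 + X)))
      ≤ Real.log (2 * K * n ^ 4 * (1 + X)) := by
        refine Real.log_le_log (by positivity) ?_
        calc 2 * n * (K * (1 + 2 * n ^ 2 + X)) ≤ 2 * n * (K * (n ^ 3 * (1 + X))) := by gcongr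
          _ = 2 * K * n ^ 4 * (1 + X) := by ring
    _ = Real.log (2 * K) + 4 * Real.log n + Real.log (1 + X) := by
        rw [Real.log_mul (by positivity) (by positivity),
          Real.log_mul (by positivity) (by positivity), Real.log_pow]
        norm_num
    _ ≤ (Real.log (2 * K) + 4) * (Real.log n * (1 + X)) := by
        have := le_mul_of_one_le_right hlogK (by linarith : 1 ≤ Real.log n * (1 + X))
        linarith

theorem one_third_le_log_div (hs : 0 < s) (hsn : 3 * s ≤ n) :
    1 / 3 ≤ Real.log (n / (2 * s)) := by
  have hsnR : 3 * (s : ℝ) ≤ n := by exact_mod_cast hsn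
  have hκ : (3 / 2 : ℝ) ≤ n / (2 * s) := by
    rw [div_le_div_iff₀ (by norm_num) (by positivity)]
    linarith
  calc (1 / 3 : ℝ) = 1 - (3 / 2)⁻¹ := by norm_num
    _ ≤ Real.log (3 / 2) := Real.one_sub_inv_le_log_of_pos (by norm_num)
    _ ≤ Real.log (n / (2 * s)) := Real.log_le_log (by norm_num) hκ

theorem exists_level_count {K X : ℝ} (hK : 1 ≤ K) (hX : 0 ≤ X) (hs : 0 < s) (hsn : 3 * s ≤ n) :
    ∃ L : ℕ, K * (1 + 2 * n ^ 2 + X) ≤ (n / (2 * s) : ℝ) ^ L / (2 * n) ∧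
      L ≤ (Real.log (2 * K) + 4) * (Real.log n * (1 + X)) / Real.log (n / (2 * s)) + 1 := by
  have hnR : (1 : ℝ) ≤ n := by exact_mod_cast (by omega : 1 ≤ n)
  have hlogκ := one_third_le_log_div hs hsn
  have hκ : 1 < (n / (2 * s) : ℝ) := (Real.log_pos_iff (by positivity)).mp (by linarith)
  have hQ : 1 ≤ 2 * n * (K * (1 + 2 * n ^ 2 + X)) :=
    one_le_mul_of_one_le_of_one_le (by linarith)
      (one_le_mul_of_one_le_of_one_le hK (by nlinarith))
  obtain ⟨L, hQL, hL⟩ := exists_le_pow_of_one_le hκ hQ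
  refine ⟨L, by rwa [le_div_iff₀' (by positivity)], hL.trans ?_⟩
  gcongr
  exact log_two_mul_degree_mul_le hK hX (by omega)

theorem log_le_log_div_of_pow_four_le (hs : 0 < s) (hn : 3 ≤ n) (hsn : s ^ 4 ≤ n) :
    Real.log n ≤ 12 * Real.log (n / (2 * s)) := by
  have hnR : (3 : ℝ) ≤ n := by exact_mod_cast hn
  have hsnR : (s : ℝ) ^ 4 ≤ n := by exact_mod_cast hsn
  have htwo : (2 : ℝ) ^ 12 ≤ n ^ 8 :=
    le_trans (by norm_num) (pow_le_pow_left₀ (by norm_num) hnR 8)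
  have hpow : (n : ℝ) ≤ (n / (2 * s)) ^ 12 := by
    rw [div_pow, le_div_iff₀ (by positivity)]
    calc (n : ℝ) * (2 * s) ^ 12 = n * (2 ^ 12 * ((s : ℝ) ^ 4) ^ 3) := by ring
      _ ≤ n * ((n : ℝ) ^ 8 * (n : ℝ) ^ 3) := by gcongr
      _ = (n : ℝ) ^ 12 := by ring
  exact_mod_cast (Real.log_le_log (by linarith) hpow).trans_eq (Real.log_pow _ _)

theorem half_le_log (hs : 2 ≤ s) : 1 / 2 ≤ Real.log s := by
  have hsR : (2 : ℝ) ≤ s := by exact_mod_cast hs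
  linarith [Real.log_le_log two_pos hsR, Real.log_two_gt_d9]

theorem log_le_log_div_mul_log (hs : 2 ≤ s) (hsn : 3 * s ≤ n) :
    Real.log n ≤ 12 * Real.log (n / (2 * s)) * Real.log s := by
  have hsR : (2 : ℝ) ≤ s := by exact_mod_cast hs
  have hnR : (0 : ℝ) < n := by exact_mod_cast (by omega : 0 < n)
  have hκ := one_third_le_log_div (by omega) hsn
  have hlogs := half_le_log hs
  have hsplit : Real.log n = Real.log (n / (2 * s)) + (Real.log 2 + Real.log s) := by
    rw [Real.log_div hnR.ne' (by positivity), Real.log_mul two_ne_zero (by positivity)]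
    ring
  have hlog2 : Real.log 2 ≤ Real.log s := Real.log_le_log two_pos hsR
  rw [hsplit]
  nlinarith

theorem exists_ncard_mediumSolutions_le (hb : b < 1) (hlam : lam a b 3 < 3) :
    ∃ K : ℝ, 0 < K ∧ ∀ (n s m : ℕ) (F : MvPolynomial (Fin 2) ℤ) (B : ℝ),
      F.IsHomogeneous n → (∀ i, ¬MvPolynomial.X i ∣ F) → #F.support = s + 1 →
      0 < s → 3 * s ≤ n → 0 < m → 1 < height F →
      1 / 2 ≤ B → Real.log n ≤ 12 * Real.log (n / (2 * s)) * B →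
      ((mediumSolutions a b F n s m).ncard : ℝ) ≤ K * (s * B * (1 + logRatio F n m)) := by
  set K₀ := (803 + 1 / a ^ 2) / (1 - lam a b 3 / 3) with hK₀
  have hK₀1 : 1 ≤ K₀ := by
    rw [hK₀, one_le_div (by linarith)]
    have : 0 ≤ 1 / a ^ 2 := by positivity
    linarith [lam_nonneg (a := a) (n := 3) hb.le]
  set K₁ := Real.log (2 * K₀) + 4
  have hK₁ : 0 < K₁ := by
    have := Real.log_nonneg (by linarith : 1 ≤ 2 * K₀)
    positivity
  refine ⟨80 * (12 * K₁ + 4), by positivity, ?_⟩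
  intro n s m F B hF hX hcard hs hsn hm hH hB hlogn
  have hlogκ := one_third_le_log_div hs hsn
  have hratio : 0 ≤ logRatio F n m := logRatio_nonneg hm
  obtain ⟨L, hreach, hL⟩ := exists_level_count hK₀1 hratio hs hsn
  have hYL : YL a b F n m ≤ (height F : ℝ) ^ ((n / (2 * s) : ℝ) ^ L / (2 * n)) :=
    (YL_le_height_rpow hb hlam hF (by omega) hm hH).trans
      (Real.rpow_le_rpow_of_exponent_le (by exact_mod_cast hH.le) hreach)
  have hlevels : (L : ℝ) ≤ 12 * K₁ * (B * (1 + logRatio F n m)) + 1 := by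
    refine hL.trans ?_
    gcongr
    rw [div_le_iff₀ (by linarith)]
    calc K₁ * (Real.log n * (1 + logRatio F n m))
        ≤ K₁ * (12 * Real.log (n / (2 * s)) * B * (1 + logRatio F n m)) := by gcongr
      _ = 12 * K₁ * (B * (1 + logRatio F n m)) * Real.log (n / (2 * s)) := by ring
  have htwo : 2 ≤ 4 * (B * (1 + logRatio F n m)) := by nlinarith
  calc ((mediumSolutions a b F n s m).ncard : ℝ) ≤ 80 * s * (L + 1) :=
        ncard_mediumSolutions_le hF hX hcard hs hsn hm (by omega) hYL
    _ ≤ 80 * s * ((12 * K₁ + 4) * (B * (1 + logRatio F n m))) := by gcongr; linarith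
    _ = 80 * (12 * K₁ + 4) * (s * B * (1 + logRatio F n m)) := by ring

end Counting

end ThueMedium

end

theorem proposition8p2_general (a b : ℝ) (ha : a ≠ 0) (hb : b < 1)
    (hsmall : Real.sqrt 2 * Real.sqrt (3 + a ^ 2) / (1 - b) < 3) :
    ∃ K : ℝ, 0 < K ∧
      ∀ (n s m : ℕ) (F : MvPolynomial (Fin 2) ℤ),
        F.IsHomogeneous n →
        (∀ i, ¬MvPolynomial.X i ∣ F) →
        F.support.card = s + 1 →
        0 < n → 3 * s ≤ n → 0 < m →
        1 < ThueMedium.height F →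
        (ThueMedium.mediumSolutions a b F n s m).Finite ∧
        (s ^ 4 ≤ n →
          ((ThueMedium.mediumSolutions a b F n s m).ncard : ℝ) ≤
            K * (s * (1 + Real.log ((m : ℝ) ^ (1 / (n : ℝ))) /
              Real.log (ThueMedium.height F)))) ∧
        (2 ≤ s →
          ((ThueMedium.mediumSolutions a b F n s m).ncard : ℝ) ≤
            K * (s * Real.log s * (1 + Real.log ((m : ℝ) ^ (1 / (n : ℝ))) /
              Real.log (ThueMedium.height F)))) := by
  obtain ⟨K, hK, hcount⟩ :=
    ThueMedium.exists_ncard_mediumSolutions_le hb (ThueMedium.lam_three.trans_lt hsmall)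
  refine ⟨K, hK, fun n s m F hF hX hcard hn hsn hm hH => ?_⟩
  have hs : 0 < s := (ThueMedium.isSparse_map_dehomogenize hF hX hcard).pos hn
  refine ⟨ThueMedium.finite_mediumSolutions a b F n s m, fun hs4 => ?_, fun hs2 => ?_⟩
  · have hlog := ThueMedium.log_le_log_div_of_pow_four_le hs (by omega) hs4
    have hbound := hcount n s m F 1 hF hX hcard hs hsn hm hH (by norm_num)
      (hlog.trans_eq (mul_one _).symm)
    rwa [mul_one] at hbound
  · exact hcount n s m F (Real.log s) hF hX hcard hs hsn hm hH (ThueMedium.half_le_log hs2)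
      (ThueMedium.log_le_log_div_mul_log hs2 hsn)

theorem proposition8p2 (a b : ℝ) (ha : 0 < a) (hab : a < b) (hb : b < 1)
    (hsmall : Real.sqrt 2 * Real.sqrt (3 + a ^ 2) / (1 - b) < 3) :
    ∃ K : ℝ, 0 < K ∧
      ∀ (n s m : ℕ) (F : MvPolynomial (Fin 2) ℤ),
        F.IsHomogeneous n →
        Irreducible (MvPolynomial.map (Int.castRingHom ℚ) F) →
        F.support.card = s + 1 →
        3 ≤ n → 3 * s ≤ n → 0 < m →
        1 < ThueMedium.height F →
        (ThueMedium.mediumSolutions a b F n s m).Finite ∧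
        (s ^ 4 ≤ n →
          ((ThueMedium.mediumSolutions a b F n s m).ncard : ℝ) ≤
            K * (s * (1 + Real.log ((m : ℝ) ^ (1 / (n : ℝ))) /
              Real.log (ThueMedium.height F)))) ∧
        (9 * s ^ 2 ≤ n → n < s ^ 4 →
          ((ThueMedium.mediumSolutions a b F n s m).ncard : ℝ) ≤
            K * (s * Real.log s * (1 + Real.log ((m : ℝ) ^ (1 / (n : ℝ))) /
              Real.log (ThueMedium.height F)))) ∧
        (2 ≤ s → n < 9 * s ^ 2 →
          ((ThueMedium.mediumSolutions a b F n s m).ncard : ℝ) ≤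
            K * (s * Real.log s * (1 + (s + Real.log ((m : ℝ) ^ (1 / (n : ℝ)))) /
              Real.log (ThueMedium.height F)))) := by
  obtain ⟨K, hK, hcount⟩ := proposition8p2_general a b ha.ne' hb hsmall
  refine ⟨K, hK, fun n s m F hF hirr hcard hn hsn hm hH => ?_⟩
  obtain ⟨hfin, hpow, hlog⟩ := hcount n s m F hF
    (ThueMedium.not_X_dvd_of_irreducible_map hF (by omega) hirr) hcard (by omega) hsn hm hH
  refine ⟨hfin, hpow, fun _ hns => hlog ?_, fun hs _ => (hlog hs).trans ?_⟩
  · by_contra! hs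
    interval_cases s <;> omega
  · gcongr
    exact le_add_of_nonneg_left s.cast_nonneg
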